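/- Let $m\ge 1$, let $K\subset\mathbb C^m$ be compact, $Q:K\to\mathbb R$ continuous, and $\tau$ a Borel probability measure on $K$ with the weighted Bernstein–Markov property: there are constants $M_n$ with $\limsup_{n\to\infty} M_n^{1/n}=1$ and $$\max_{z\in K}|p(z)|e^{-nQ(z)}\le M_n\Bigl(\int_K|p|^2e^{-2nQ}\,d\tau\Bigr)^{1/2}$$ for all $n\ge1$ and all $p\in\mathcal P_n$, the space of complex polynomials on $\mathbb C^m$ of degree at most $n$. Let $$V_{K,Q}(z)=\sup\Bigl\{\tfrac1{\deg p}\log|p(z)| : p \text{ a polynomial},\ \deg p\ge 1,\ |p|\,e^{-(\deg p)Q}\le 1\text{ on }K\Bigr\},$$ and assume that $V_{K,Q}$ is finite and continuous on $\mathbb C^m$. Let $m_n=\dim\mathcal P_n=\binom{m+n}{n}$. For each $n\ge 1$ let $p^{(n)}_1,\dots,p^{(n)}_{m_n}$ be an orthonormal basis of $\mathcal P_n$ in $L^2(e^{-2nQ}\tau)$, let $\mathrm{Prob}_{m_n}$ be a Borel probability measure on $\mathbb C^{m_n}$, and let $H_n=\sum_j a_jp^{(n)}_j$ be the random polynomial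 whose coefficient vector $a=a^{(n)}$ has law $\mathrm{Prob}_{m_n}$. Suppose that for all $n\ge2$ and all $u\in\mathbb C^{m_n}$ with $|u|=1$ the function $a\mapsto\log|\langle a,u\rangle|$ (with $\log 0=-\infty$) is $\mathrm{Prob}_{m_n}$-integrable, and that there is a constant $C$, independent of $n$ and $u$, with $$|I_n(u)|\le C\log n,\qquad I_n(u):=\int_{\mathbb C^{m_n}}\log|\langle a,u\rangle|\,d\mathrm{Prob}_{m_n}(a),\qquad n\ge2,\ |u|=1.$$ With $dd^c=\frac i\pi\partial\bar\partial$, let $\tilde Z_{H_n}=\frac1n dd^c\log|H_n|$ be the normalized zero current, and let its expectation be the current of bidegree $(1,1)$ acting on smooth compactly supported $(m-1,m-1)$-forms $\alpha$ on $\mathbb C^m$ by $$\bigl(E(\tilde Z_{H_n}),\alpha\bigr)=\int_{\mathbb C^{m_n}}(\tilde Z_{H_n},\alpha)\,d\mathrm{Prob}_{m_n}(a),\qquad (\tilde Z_{H_n},\alpha)=\frac1n\int_{\mathbb C^m}\log|H_n|\,dd^c\alpha .$$ Then for $n\ge 2$ these are well defined (almost surely $\log|H_n|\in L^1_{\rm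 loc}(\mathbb C^m)$, and $a\mapsto(\tilde Z_{H_n},\alpha)$ is integrable for every such $\alpha$), and $$\lim_{n\to\infty}E(\tilde Z_{H_n})=dd^cV_{K,Q}$$ as currents, i.e. $\bigl(E(\tilde Z_{H_n}),\alpha\bigr)\to\int_{\mathbb C^m}V_{K,Q}\,dd^c\alpha$ for every smooth compactly supported $(m-1,m-1)$-form $\alpha$ on $\mathbb C^m$. -/

import Mathlib

open MeasureTheory Filter Topology
open scoped ENNReal NNReal ContDiff ComplexConjugate

noncomputable section

/-! ### Weighted pluripotential theory -/

/-- The constraint that `p` has weighted sup norm at most one on `K`, the weight being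
`e^{-nQ}`: `|p(z)| e^{-n Q(z)} ≤ 1` for all `z ∈ K`. -/
def WeightedNormLeOne {m : ℕ} (K : Set (Fin m → ℂ)) (Q : (Fin m → ℂ) → ℝ) (n : ℕ)
    (p : MvPolynomial (Fin m) ℂ) : Prop :=
  ∀ z ∈ K, ‖MvPolynomial.eval z p‖ * Real.exp (-(n : ℝ) * Q z) ≤ 1

/-- The weighted pluricomplex Green function
`V_{K,Q}(z) = sup { (1 / deg p) log |p(z)| : p a polynomial, ‖p e^{-(deg p) Q}‖_K ≤ 1 }`,
the supremum being over the polynomials of degree at least one (so that `1 / deg p` makes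
sense). It takes values in `[-∞, +∞]`, and `log 0 = -∞`. -/
def weightedGreen {m : ℕ} (K : Set (Fin m → ℂ)) (Q : (Fin m → ℂ) → ℝ) (z : Fin m → ℂ) : EReal :=
  ⨆ (p : MvPolynomial (Fin m) ℂ) (_ : 1 ≤ p.totalDegree)
    (_ : WeightedNormLeOne K Q p.totalDegree p),
    ENNReal.log ‖MvPolynomial.eval z p‖ₑ / ((p.totalDegree : ℝ) : EReal)

/-- The weighted Bernstein-Markov property of `(K, Q, τ)`:
`‖p e^{-nQ}‖_K ≤ M_n ‖p e^{-nQ}‖_{L²(τ)}` for all polynomials `p` of degree at most `n`,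
`n = 1, 2, …`, where `limsup M_n^{1/n} = 1`. -/
def WeightedBernsteinMarkov {m : ℕ} (K : Set (Fin m → ℂ)) (Q : (Fin m → ℂ) → ℝ)
    (τ : Measure (Fin m → ℂ)) : Prop :=
  ∃ M : ℕ → ℝ≥0,
    (∀ n : ℕ, 1 ≤ n → ∀ p : MvPolynomial (Fin m) ℂ, p.totalDegree ≤ n → ∀ z ∈ K,
      ‖MvPolynomial.eval z p‖ * Real.exp (-(n : ℝ) * Q z) ≤
        M n * Real.sqrt (∫ w, (‖MvPolynomial.eval w p‖ * Real.exp (-(n : ℝ) * Q w)) ^ 2 ∂τ)) ∧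
    limsup (fun n : ℕ => (M n : ℝ≥0∞) ^ (1 / (n : ℝ))) atTop = 1

/-- `p` is an orthonormal basis, for the inner product of `L²(e^{-2nQ} τ)`, of the space of
polynomials of degree at most `n`. -/
structure IsOrthonormalPolyBasis {m : ℕ} {ι : Type*} [DecidableEq ι] (Q : (Fin m → ℂ) → ℝ)
    (τ : Measure (Fin m → ℂ)) (n : ℕ) (p : ι → MvPolynomial (Fin m) ℂ) : Prop where
  span_eq : Submodule.span ℂ (Set.range p) = MvPolynomial.restrictTotalDegree (Fin m) ℂ n
  orthonormal : ∀ i j, ∫ z, MvPolynomial.eval z (p i) * conj (MvPolynomial.eval z (p j)) *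
    (Real.exp (-2 * (n : ℝ) * Q z) : ℂ) ∂τ = if i = j then 1 else 0

/-- The polynomial `H = ∑ a_i p_i` with coefficient vector `a`. -/
def polyOfCoeffs {m N : ℕ} (p : Fin N → MvPolynomial (Fin m) ℂ) (a : EuclideanSpace ℂ (Fin N)) :
    MvPolynomial (Fin m) ℂ :=
  ∑ i, MvPolynomial.C (a i) * p i

/-! ### Forms and currents on `ℂ^m` -/

/-- Pullback of alternating forms under multiplication by `i`:
`(J β)(v₁, …, v_k) = β(i v₁, …, i v_k)`. On forms of type `(p, q)` it is multiplication by
`i^(p - q)`. -/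
def formJ {m k : ℕ} (β : (Fin m → ℂ) [⋀^Fin k]→L[ℝ] ℂ) : (Fin m → ℂ) [⋀^Fin k]→L[ℝ] ℂ :=
  β.compContinuousLinearMap
    ((Complex.I • ContinuousLinearMap.id ℂ (Fin m → ℂ)).restrictScalars ℝ)

/-- `d^c α = (i / 2π) (∂̄ - ∂) α` for a form `α` of type `(p, p)`: since `dα = ∂α + ∂̄α` with
`∂α` of type `(p + 1, p)` and `∂̄α` of type `(p, p + 1)`, one has `J(dα) = i ∂α - i ∂̄α`, hence
`d^c α = -(1 / 2π) J(dα)`. -/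
def dcForm {m k : ℕ} (α : (Fin m → ℂ) → (Fin m → ℂ) [⋀^Fin k]→L[ℝ] ℂ) :
    (Fin m → ℂ) → (Fin m → ℂ) [⋀^Fin (k + 1)]→L[ℝ] ℂ :=
  fun z => (-(1 / (2 * Real.pi)) : ℝ) • formJ (extDeriv α z)

/-- `dd^c α = (i / π) ∂∂̄ α` for a form `α` of type `(p, p)`. -/
def ddcForm {m k : ℕ} (α : (Fin m → ℂ) → (Fin m → ℂ) [⋀^Fin k]→L[ℝ] ℂ) :
    (Fin m → ℂ) → (Fin m → ℂ) [⋀^Fin (k + 1 + 1)]→L[ℝ] ℂ :=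
  extDeriv (dcForm α)

/-- A test form of bidegree `(m - 1, m - 1)` on `ℂ^m`: a form of degree `2(m - 1)` with smooth,
compactly supported complex coefficients, which is of type `(m - 1, m - 1)` at every point, that
is, `α_z(c v₁, …, c v_{2(m-1)}) = c^{m-1} c̄^{m-1} α_z(v₁, …, v_{2(m-1)})` for `c ∈ ℂ`. -/
structure IsTestForm {m : ℕ} (α : (Fin m → ℂ) → (Fin m → ℂ) [⋀^Fin (2 * (m - 1))]→L[ℝ] ℂ) :
    Prop where
  smooth : ContDiff ℝ ∞ α
  compactSupport : HasCompactSupport α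
  bidegree : ∀ (z : Fin m → ℂ) (c : ℂ) (v : Fin (2 * (m - 1)) → Fin m → ℂ),
    α z (fun i => c • v i) = c ^ (m - 1) * conj c ^ (m - 1) * α z v

/-- The positively oriented real frame `(e₁, i e₁, …, e_m, i e_m)` of `ℂ^m`
(`k = 2m`, and `j = 0, …, 2m - 1`). -/
def stdFrame (m k : ℕ) (j : Fin k) : Fin m → ℂ :=
  fun l => if (j : ℕ) = 2 * l then 1 else if (j : ℕ) = 2 * l + 1 then Complex.I else 0

/-- The current `dd^c u` of bidegree `(1, 1)` on `ℂ^m`, `m ≥ 1`, of a locally integrable function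
`u`, acting on a test form `α` of bidegree `(m - 1, m - 1)`:
`(dd^c u, α) = ∫ u dd^c α`. The integral of a form `f dx₁ ∧ dy₁ ∧ … ∧ dx_m ∧ dy_m` of top degree
`2m = 2(m - 1) + 2` is that of `f` against Lebesgue measure. -/
def ddcCurrent {m : ℕ} (u : (Fin m → ℂ) → ℝ)
    (α : (Fin m → ℂ) → (Fin m → ℂ) [⋀^Fin (2 * (m - 1))]→L[ℝ] ℂ) : ℂ :=
  ∫ z, (u z : ℂ) * ddcForm α z (stdFrame m (2 * (m - 1) + 1 + 1))

/-- `log |H|` for a polynomial `H`. -/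
def logAbs {m : ℕ} (H : MvPolynomial (Fin m) ℂ) (z : Fin m → ℂ) : ℝ :=
  Real.log ‖MvPolynomial.eval z H‖

/-- The normalized zero current `(1 / n) dd^c log |H|`. -/
def normalizedZeroCurrent {m : ℕ} (n : ℕ) (H : MvPolynomial (Fin m) ℂ)
    (α : (Fin m → ℂ) → (Fin m → ℂ) [⋀^Fin (2 * (m - 1))]→L[ℝ] ℂ) : ℂ :=
  (1 / (n : ℂ)) * ddcCurrent (logAbs H) α

/-- The expectation of the normalized zero current of `H = ∑ a_i p_i`, where the coefficient
vector `a` has law `P`: the average over `a` of the action on a test form. -/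
def expectedZeroCurrent {m N : ℕ} (n : ℕ) (p : Fin N → MvPolynomial (Fin m) ℂ)
    (P : Measure (EuclideanSpace ℂ (Fin N)))
    (α : (Fin m → ℂ) → (Fin m → ℂ) [⋀^Fin (2 * (m - 1))]→L[ℝ] ℂ) : ℂ :=
  ∫ a, normalizedZeroCurrent n (polyOfCoeffs p a) α ∂P

/-! ### Logarithmic averages -/

/-- `a ↦ log |⟨a, u⟩|`, with `log 0 = -∞`, is integrable for `P`: the value `-∞` has probability
zero and the real-valued function is integrable. -/
def LogInnerIntegrable {N : ℕ} (P : Measure (EuclideanSpace ℂ (Fin N)))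
    (u : EuclideanSpace ℂ (Fin N)) : Prop :=
  (∀ᵐ a ∂P, inner ℂ u a ≠ 0) ∧ Integrable (fun a => Real.log ‖inner ℂ u a‖) P

/-- `I(u) = ∫ log |⟨a, u⟩| dP(a)`. (The inner product of Mathlib is linear in its second
argument.) -/
def logAverage {N : ℕ} (P : Measure (EuclideanSpace ℂ (Fin N)))
    (u : EuclideanSpace ℂ (Fin N)) : ℝ :=
  ∫ a, Real.log ‖inner ℂ u a‖ ∂P

end

noncomputable section

/-! ### The form `dd^c α` of a test form -/

/-! Write `H_n(z) = ⟨a, Φ_n(z)⟩`, where `Φ_n(z) = polyVec (p n) z` collects the conjugated values of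
the orthonormal basis. Splitting `Φ_n` into length and direction gives `E log |H_n(z)| = log
‖Φ_n(z)‖ + I_n(u)` with `|u| = 1`, and the last term is at most `C log n` in absolute value. After
division by `n` the randomness disappears, and what remains is the deterministic limit `(1/n) log
‖Φ_n‖ → V_{K,Q}`, a statement on the diagonal Bergman kernel `‖Φ_n‖²`
(`tendsto_log_norm_polyVec_div`).

Upper bound: by Bernstein–Markov each basis element is at most `M_n e^{nQ}` on `K`, hence at most
`max(1, M_n) e^{nV}` everywhere, and there are only polynomially many of them. Lower bound: for a
competitor `q` of degree `d` in the definition of `V`, the power `q^⌊n/d⌋` lies in `P_n`, and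
Cauchy–Schwarz in the orthonormal basis bounds it by a constant times `‖Φ_n‖`.

Fubini moves the expectation inside the current (`expectedZeroCurrent_eq`), and dominated
convergence on the support of `dd^c α` concludes. Fubini needs `L¹` bounds on `log |⟨a, u⟩|` uniform
in `u` for each fixed `n`; these follow from `log⁺ |⟨a, u⟩|` having an integrable majorant
independent of `u`, together with the lower bound on `I_n`. -/

theorem ContDiff.extDeriv_of_top {E F : Type*} [NormedAddCommGroup E] [NormedSpace ℝ E]
    [NormedAddCommGroup F] [NormedSpace ℝ F] {k : ℕ} {α : E → E [⋀^Fin k]→L[ℝ] F}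
    (hα : ContDiff ℝ ∞ α) : ContDiff ℝ ∞ (extDeriv α) :=
  (ContinuousAlternatingMap.alternatizeUncurryFinCLM ℝ E F).contDiff.comp
    (hα.fderiv_right (by simp))

theorem HasCompactSupport.extDeriv {E F : Type*} [NormedAddCommGroup E] [NormedSpace ℝ E]
    [NormedAddCommGroup F] [NormedSpace ℝ F] {k : ℕ} {α : E → E [⋀^Fin k]→L[ℝ] F}
    (hα : HasCompactSupport α) : HasCompactSupport (extDeriv α) :=
  (hα.fderiv ℝ).comp_left (g := ContinuousAlternatingMap.alternatizeUncurryFinCLM ℝ E F)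
    (map_zero _)

theorem formJ_eq_compContinuousLinearMapCLM {m k : ℕ} :
    (formJ : ((Fin m → ℂ) [⋀^Fin k]→L[ℝ] ℂ) → _) =
      ContinuousAlternatingMap.compContinuousLinearMapCLM
        ((Complex.I • ContinuousLinearMap.id ℂ (Fin m → ℂ)).restrictScalars ℝ) := rfl

theorem continuous_ddcForm {m k : ℕ} {α : (Fin m → ℂ) → (Fin m → ℂ) [⋀^Fin k]→L[ℝ] ℂ}
    (hα : ContDiff ℝ ∞ α) : Continuous (ddcForm α) := by
  have h : ContDiff ℝ ∞ (dcForm α) := by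
    unfold dcForm
    rw [formJ_eq_compContinuousLinearMapCLM]
    exact ((ContinuousLinearMap.contDiff _).comp hα.extDeriv_of_top).const_smul _
  exact h.extDeriv_of_top.continuous

theorem hasCompactSupport_ddcForm {m k : ℕ}
    {α : (Fin m → ℂ) → (Fin m → ℂ) [⋀^Fin k]→L[ℝ] ℂ} (hα : HasCompactSupport α) :
    HasCompactSupport (ddcForm α) := by
  have h : HasCompactSupport (dcForm α) :=
    hα.extDeriv.comp_left (g := fun β => (-(1 / (2 * Real.pi)) : ℝ) • formJ β)
      (by ext; simp [formJ])
  exact h.extDeriv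

/-! ### Logarithmic averages -/

/-- If `a ↦ log |⟨a, u⟩|` is integrable for all unit vectors `u`, with integrals bounded below,
then it is bounded in `L¹(P)`. -/
theorem exists_integral_abs_log_inner_le {N : ℕ} {P : Measure (EuclideanSpace ℂ (Fin N))}
    [IsProbabilityMeasure P] (hI : ∀ u, ‖u‖ = 1 → LogInnerIntegrable P u) {c : ℝ}
    (hc : ∀ u, ‖u‖ = 1 → -c ≤ logAverage P u) :
    ∃ D : ℝ, ∀ u : EuclideanSpace ℂ (Fin N), ‖u‖ = 1 →
      ∫ a, |Real.log ‖inner ℂ u a‖| ∂P ≤ D := by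
  set e : Fin N → EuclideanSpace ℂ (Fin N) := fun i => EuclideanSpace.single i (1 : ℂ)
  -- A majorant of `log⁺ |⟨a, u⟩|` for all unit `u` at once: `|⟨a, u⟩| ≤ ‖a‖ ≤ ∑ |a_i|`, and `log⁺`
  -- of a sum of `N` terms is at most `log N` plus the sum of the `log⁺`. It is integrable by the
  -- hypothesis at the coordinate vectors.
  set F : EuclideanSpace ℂ (Fin N) → ℝ :=
    fun a => Real.log N + ∑ i, |Real.log ‖inner ℂ (e i) a‖|
  have hF : Integrable F P := by
    refine (integrable_const _).add (integrable_finsetSum _ fun i _ => ?_)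
    exact (hI (e i) (by simp [e])).2.abs
  have hpos : ∀ u : EuclideanSpace ℂ (Fin N), ‖u‖ = 1 → ∀ a,
      Real.posLog ‖inner ℂ u a‖ ≤ F a := by
    intro u hu a
    have h1 : ‖inner ℂ u a‖ ≤ ‖∑ i, ‖a i‖‖ := by
      calc ‖inner ℂ u a‖ ≤ ‖u‖ * ‖a‖ := norm_inner_le_norm _ _
        _ = ‖a‖ := by rw [hu, one_mul]
        _ = ‖∑ i, EuclideanSpace.single i (a i)‖ := by
            congr 1
            ext j
            simp [Finset.sum_apply]
        _ ≤ ∑ i, ‖EuclideanSpace.single i (a i)‖ := norm_sum_le _ _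
        _ = ∑ i, ‖a i‖ := by simp
        _ ≤ ‖∑ i, ‖a i‖‖ := le_abs_self _
    refine (Real.posLog_le_posLog (norm_nonneg _) h1).trans ?_
    rw [Real.norm_eq_abs, Real.posLog_abs]
    refine (Real.posLog_sum _ _).trans ?_
    simp only [Finset.card_univ, Fintype.card_fin, F]
    gcongr with i
    have : inner ℂ (e i) a = a i := by simp [e, EuclideanSpace.inner_single_left]
    rw [this, Real.posLog_apply]
    exact max_le (abs_nonneg _) (le_abs_self _)
  refine ⟨2 * ∫ a, F a ∂P + c, fun u hu => ?_⟩
  have hlog := (hI u hu).2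
  calc ∫ a, |Real.log ‖inner ℂ u a‖| ∂P
      ≤ ∫ a, (2 * F a - Real.log ‖inner ℂ u a‖) ∂P := by
        refine integral_mono hlog.abs ((hF.const_mul 2).sub hlog) fun a => ?_
        -- `|log x| = 2 log⁺ x - log x`, so an upper bound on `log⁺` and a lower bound on the mean
        -- control the `L¹` norm.
        have := Real.half_mul_log_add_log_abs (x := ‖inner ℂ u a‖)
        have := hpos u hu a
        dsimp only
        linarith
    _ = 2 * ∫ a, F a ∂P - logAverage P u := by
        rw [integral_sub (hF.const_mul 2) hlog, integral_const_mul, logAverage]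
    _ ≤ _ := by linarith [hc u hu]

section Average

variable {N : ℕ} {P : Measure (EuclideanSpace ℂ (Fin N))}

theorem inner_eq_norm_mul_inner_normalize (v a : EuclideanSpace ℂ (Fin N)) (hv : v ≠ 0) :
    ‖inner ℂ v a‖ = ‖v‖ * ‖inner ℂ ((‖v‖⁻¹ : ℂ) • v) a‖ := by
  have : ‖v‖ ≠ 0 := norm_ne_zero_iff.2 hv
  rw [inner_smul_left]
  simp [mul_inv_cancel_left₀ this]

theorem norm_normalize_eq_one (v : EuclideanSpace ℂ (Fin N)) (hv : v ≠ 0) :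
    ‖(‖v‖⁻¹ : ℂ) • v‖ = 1 := by
  have : ‖v‖ ≠ 0 := norm_ne_zero_iff.2 hv
  simp [norm_smul, this]

/-- Only almost everywhere: where the inner product vanishes, `Real.log 0 = 0` breaks additivity. -/
theorem log_norm_inner_ae_eq [IsProbabilityMeasure P]
    (hI : ∀ u, ‖u‖ = 1 → LogInnerIntegrable P u) {v : EuclideanSpace ℂ (Fin N)} (hv : v ≠ 0) :
    (fun a => Real.log ‖inner ℂ v a‖) =ᵐ[P]
      fun a => Real.log ‖v‖ + Real.log ‖inner ℂ ((‖v‖⁻¹ : ℂ) • v) a‖ := by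
  filter_upwards [(hI _ (norm_normalize_eq_one v hv)).1] with a ha
  rw [inner_eq_norm_mul_inner_normalize v a hv,
    Real.log_mul (norm_ne_zero_iff.2 hv) (norm_ne_zero_iff.2 ha)]

theorem integrable_log_norm_inner [IsProbabilityMeasure P]
    (hI : ∀ u, ‖u‖ = 1 → LogInnerIntegrable P u) {v : EuclideanSpace ℂ (Fin N)} (hv : v ≠ 0) :
    Integrable (fun a => Real.log ‖inner ℂ v a‖) P :=
  ((integrable_const _).add (hI _ (norm_normalize_eq_one v hv)).2).congr
    (log_norm_inner_ae_eq hI hv).symm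

theorem integral_log_norm_inner [IsProbabilityMeasure P]
    (hI : ∀ u, ‖u‖ = 1 → LogInnerIntegrable P u) {v : EuclideanSpace ℂ (Fin N)} (hv : v ≠ 0) :
    ∫ a, Real.log ‖inner ℂ v a‖ ∂P = Real.log ‖v‖ + logAverage P ((‖v‖⁻¹ : ℂ) • v) := by
  rw [integral_congr_ae (log_norm_inner_ae_eq hI hv),
    integral_add (integrable_const _) (hI _ (norm_normalize_eq_one v hv)).2, logAverage]
  simp

theorem measurable_log_norm_inner {Z : Type*} [MeasurableSpace Z]
    {φ : Z → EuclideanSpace ℂ (Fin N)} (hφ : Measurable φ) :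
    Measurable (fun q : EuclideanSpace ℂ (Fin N) × Z => Real.log ‖inner ℂ (φ q.2) q.1‖) :=
  Real.measurable_log.comp ((hφ.comp measurable_snd).inner measurable_fst).norm

/-- Tonelli: for fixed `z` the `L¹(P)` norm is at most `|log ‖φ z‖| + D`, which is integrable in
`z`. The uniformity of `D` in the direction of `φ z` is essential. -/
theorem integrable_prod_log_norm_inner [IsProbabilityMeasure P]
    (hI : ∀ u, ‖u‖ = 1 → LogInnerIntegrable P u) {D : ℝ}
    (hD : ∀ u : EuclideanSpace ℂ (Fin N), ‖u‖ = 1 → ∫ a, |Real.log ‖inner ℂ u a‖| ∂P ≤ D)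
    {Z : Type*} [MeasurableSpace Z] {μ : Measure Z} [IsFiniteMeasure μ]
    {φ : Z → EuclideanSpace ℂ (Fin N)} (hφ : Measurable φ) (hφ0 : ∀ z, φ z ≠ 0)
    (hlog : Integrable (fun z => Real.log ‖φ z‖) μ) :
    Integrable (fun q : EuclideanSpace ℂ (Fin N) × Z => Real.log ‖inner ℂ (φ q.2) q.1‖)
      (P.prod μ) := by
  have hmeas := measurable_log_norm_inner hφ
  have hint : ∀ z, Integrable (fun a => Real.log ‖inner ℂ (φ z) a‖) P :=
    fun z => integrable_log_norm_inner hI (hφ0 z)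
  refine (integrable_prod_iff' hmeas.aestronglyMeasurable).2 ⟨.of_forall hint, ?_⟩
  have hmeas' : Measurable
      (fun q : Z × EuclideanSpace ℂ (Fin N) => ‖Real.log ‖inner ℂ (φ q.1) q.2‖‖) :=
    (hmeas.comp measurable_swap).norm
  refine Integrable.mono' (hlog.abs.add (integrable_const D))
    (hmeas'.aestronglyMeasurable (μ := μ.prod P)).integral_prod_right' (.of_forall fun z => ?_)
  have hu := norm_normalize_eq_one (φ z) (hφ0 z)
  rw [Real.norm_of_nonneg (integral_nonneg fun _ => norm_nonneg _)]
  calc ∫ a, ‖Real.log ‖inner ℂ (φ z) a‖‖ ∂P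
      ≤ ∫ a, (|Real.log ‖φ z‖| + |Real.log ‖inner ℂ ((‖φ z‖⁻¹ : ℂ) • φ z) a‖|) ∂P := by
        refine integral_mono_ae (integrable_log_norm_inner hI (hφ0 z)).norm
          ((integrable_const _).add (hI _ hu).2.abs) ?_
        filter_upwards [log_norm_inner_ae_eq hI (hφ0 z)] with a ha
        rw [ha]
        exact abs_add_le _ _
    _ = |Real.log ‖φ z‖| + ∫ a, |Real.log ‖inner ℂ ((‖φ z‖⁻¹ : ℂ) • φ z) a‖| ∂P := by
        rw [integral_add (integrable_const _) (hI _ hu).2.abs]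
        simp
    _ ≤ |Real.log ‖φ z‖| + D := by gcongr; exact hD _ hu

end Average

/-! ### Orthonormal bases of polynomials -/

/-- The vector of the complex conjugates of the values at `z` of a family of polynomials. -/
def polyVec {m N : ℕ} (p : Fin N → MvPolynomial (Fin m) ℂ) (z : Fin m → ℂ) :
    EuclideanSpace ℂ (Fin N) :=
  WithLp.toLp 2 fun i => conj (MvPolynomial.eval z (p i))

theorem inner_polyVec {m N : ℕ} (p : Fin N → MvPolynomial (Fin m) ℂ) (z : Fin m → ℂ)
    (a : EuclideanSpace ℂ (Fin N)) :
    inner ℂ (polyVec p z) a = MvPolynomial.eval z (polyOfCoeffs p a) := by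
  simp [polyVec, polyOfCoeffs, PiLp.inner_apply]

theorem continuous_polyVec {m N : ℕ} (p : Fin N → MvPolynomial (Fin m) ℂ) :
    Continuous (polyVec p) := by
  refine (PiLp.continuous_toLp 2 _).comp (continuous_pi fun i => ?_)
  exact Complex.continuous_conj.comp (MvPolynomial.continuous_eval (p i))

section Orthonormal

variable {m N n : ℕ} {K : Set (Fin m → ℂ)} {Q : (Fin m → ℂ) → ℝ} {τ : Measure (Fin m → ℂ)}
  {p : Fin N → MvPolynomial (Fin m) ℂ}

theorem IsOrthonormalPolyBasis.exists_coeffs (hp : IsOrthonormalPolyBasis Q τ n p)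
    {q : MvPolynomial (Fin m) ℂ} (hq : q.totalDegree ≤ n) :
    ∃ c : EuclideanSpace ℂ (Fin N), polyOfCoeffs p c = q := by
  have h : q ∈ Submodule.span ℂ (Set.range p) := by
    rw [hp.span_eq]
    exact (MvPolynomial.mem_restrictTotalDegree _ _ _).2 hq
  obtain ⟨c, hc⟩ := (Submodule.mem_span_range_iff_exists_fun ℂ).1 h
  exact ⟨WithLp.toLp 2 c, by simpa [polyOfCoeffs, MvPolynomial.C_mul'] using hc⟩

theorem IsOrthonormalPolyBasis.totalDegree_le (hp : IsOrthonormalPolyBasis Q τ n p) (i : Fin N) :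
    (p i).totalDegree ≤ n := by
  rw [← MvPolynomial.mem_restrictTotalDegree, ← hp.span_eq]
  exact Submodule.subset_span ⟨i, rfl⟩

/-- The constant `1` is in the span, so the basis has no common zero. -/
theorem IsOrthonormalPolyBasis.polyVec_ne_zero (hp : IsOrthonormalPolyBasis Q τ n p)
    (z : Fin m → ℂ) : polyVec p z ≠ 0 := by
  intro h
  obtain ⟨c, hc⟩ := hp.exists_coeffs (q := 1) (by simp)
  have := inner_polyVec p z c
  simp [hc, h] at this

theorem integrable_eval_mul_conj_eval_mul_exp [IsFiniteMeasure τ] (hK : IsCompact K)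
    (hQ : ContinuousOn Q K) (hτ : τ Kᶜ = 0) (f g : MvPolynomial (Fin m) ℂ) (n : ℕ) :
    Integrable (fun z => MvPolynomial.eval z f * conj (MvPolynomial.eval z g) *
      (Real.exp (-2 * (n : ℝ) * Q z) : ℂ)) τ := by
  rw [← Measure.restrict_eq_self_of_ae_mem (s := K) (μ := τ) (mem_ae_iff.2 hτ)]
  refine ContinuousOn.integrableOn_compact hK ?_
  have hf := (MvPolynomial.continuous_eval f).continuousOn (s := K)
  have hg := (Complex.continuous_conj.comp (MvPolynomial.continuous_eval g)).continuousOn (s := K)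
  refine (hf.mul hg).mul ?_
  exact Complex.continuous_ofReal.comp_continuousOn
    (Real.continuous_exp.comp_continuousOn (continuousOn_const.mul hQ))

/-- Links the complex integrand of the orthonormality relations to the real one of the
Bernstein–Markov inequality. -/
theorem mul_conj_mul_exp_eq (w : ℂ) (n : ℕ) (t : ℝ) :
    w * conj w * (Real.exp (-2 * (n : ℝ) * t) : ℂ) =
      (((‖w‖ * Real.exp (-(n : ℝ) * t)) ^ 2 : ℝ) : ℂ) := by
  rw [Complex.mul_conj, Complex.normSq_eq_norm_sq, ← Complex.ofReal_mul, mul_pow,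
    ← Real.exp_nat_mul]
  congr 3
  push_cast
  ring

theorem IsOrthonormalPolyBasis.integral_sq_eq_one (hp : IsOrthonormalPolyBasis Q τ n p)
    (i : Fin N) :
    ∫ w, (‖MvPolynomial.eval w (p i)‖ * Real.exp (-(n : ℝ) * Q w)) ^ 2 ∂τ = 1 := by
  have h := hp.orthonormal i i
  simp only [mul_conj_mul_exp_eq, if_true] at h
  rw [integral_complex_ofReal] at h
  exact_mod_cast h

theorem IsOrthonormalPolyBasis.integral_sq_polyOfCoeffs [IsFiniteMeasure τ]
    (hp : IsOrthonormalPolyBasis Q τ n p) (hK : IsCompact K)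
    (hQ : ContinuousOn Q K) (hτ : τ Kᶜ = 0) (c : EuclideanSpace ℂ (Fin N)) :
    ∫ w, (‖MvPolynomial.eval w (polyOfCoeffs p c)‖ * Real.exp (-(n : ℝ) * Q w)) ^ 2 ∂τ =
      ‖c‖ ^ 2 := by
  have hint := fun i j : Fin N =>
    (integrable_eval_mul_conj_eval_mul_exp hK hQ hτ (p i) (p j) n).const_mul (c i * conj (c j))
  have key : ∫ z, MvPolynomial.eval z (polyOfCoeffs p c) *
      conj (MvPolynomial.eval z (polyOfCoeffs p c)) * (Real.exp (-2 * (n : ℝ) * Q z) : ℂ) ∂τ =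
      ((‖c‖ ^ 2 : ℝ) : ℂ) := by
    calc _ = ∫ z, ∑ i, ∑ j, c i * conj (c j) * (MvPolynomial.eval z (p i) *
            conj (MvPolynomial.eval z (p j)) * (Real.exp (-2 * (n : ℝ) * Q z) : ℂ)) ∂τ := by
          refine integral_congr_ae (.of_forall fun z => ?_)
          simp only [polyOfCoeffs, map_sum, map_mul, MvPolynomial.eval_C]
          rw [Finset.sum_mul_sum, Finset.sum_mul]
          refine Finset.sum_congr rfl fun i _ => ?_
          rw [Finset.sum_mul]
          refine Finset.sum_congr rfl fun j _ => ?_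
          ring
      _ = ∑ i, ∑ j, c i * conj (c j) * (if i = j then 1 else 0) := by
          rw [integral_finsetSum _ fun i _ => integrable_finsetSum _ fun j _ => hint i j]
          refine Finset.sum_congr rfl fun i _ => ?_
          rw [integral_finsetSum _ fun j _ => hint i j]
          refine Finset.sum_congr rfl fun j _ => ?_
          rw [integral_const_mul, hp.orthonormal]
      _ = _ := by
          simp [EuclideanSpace.norm_sq_eq, Complex.mul_conj, Complex.normSq_eq_norm_sq]
  simp only [mul_conj_mul_exp_eq] at key
  rw [integral_complex_ofReal] at key
  exact_mod_cast key

/-- The values of a polynomial of degree at most `n` are controlled by the Bergman function. -/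
theorem IsOrthonormalPolyBasis.norm_eval_le [IsProbabilityMeasure τ]
    (hp : IsOrthonormalPolyBasis Q τ n p) (hK : IsCompact K)
    (hQ : ContinuousOn Q K) (hτ : τ Kᶜ = 0) {q : MvPolynomial (Fin m) ℂ}
    (hq : q.totalDegree ≤ n) {A : ℝ} (hA : 0 ≤ A)
    (hqA : ∀ z ∈ K, ‖MvPolynomial.eval z q‖ * Real.exp (-(n : ℝ) * Q z) ≤ A) (z : Fin m → ℂ) :
    ‖MvPolynomial.eval z q‖ ≤ A * ‖polyVec p z‖ := by
  obtain ⟨c, rfl⟩ := hp.exists_coeffs hq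
  have hc : ‖c‖ ≤ A := by
    -- By Parseval `‖c‖` is the weighted `L²` norm, which is at most the weighted sup norm because
    -- `τ` is a probability measure carried by `K`.
    refine le_of_sq_le_sq ?_ hA
    rw [← hp.integral_sq_polyOfCoeffs hK hQ hτ c]
    calc _ ≤ ∫ _, A ^ 2 ∂τ := by
          refine integral_mono_of_nonneg (.of_forall fun _ => sq_nonneg _) (integrable_const _) ?_
          have : ∀ᵐ w ∂τ, w ∈ K := mem_ae_iff.2 hτ
          filter_upwards [this] with w hw
          exact pow_le_pow_left₀ (by positivity) (hqA w hw) 2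
      _ = A ^ 2 := by simp
  rw [← inner_polyVec]
  calc _ ≤ ‖polyVec p z‖ * ‖c‖ := norm_inner_le_norm _ _
    _ ≤ A * ‖polyVec p z‖ := by rw [mul_comm]; gcongr

end Orthonormal

theorem MvPolynomial.totalDegree_C_mul_of_ne_zero {σ R : Type*} [CommRing R] [IsDomain R] {c : R}
    (hc : c ≠ 0) (q : MvPolynomial σ R) : (MvPolynomial.C c * q).totalDegree = q.totalDegree := by
  rcases eq_or_ne q 0 with rfl | hq
  · simp
  · rw [MvPolynomial.totalDegree_mul_of_isDomain (by simpa using hc) hq,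
      MvPolynomial.totalDegree_C, zero_add]

/-! ### The weighted Green function and the Bergman functions -/

section Green

variable {m n : ℕ} {K : Set (Fin m → ℂ)} {Q V : (Fin m → ℂ) → ℝ}

theorem log_enorm_div_natCast_eq {w : ℂ} (hw : w ≠ 0) (d : ℕ) :
    ENNReal.log ‖w‖ₑ / ((d : ℝ) : EReal) = ((Real.log ‖w‖ / d : ℝ) : EReal) := by
  rw [← ofReal_norm, ENNReal.log_ofReal_of_pos (norm_pos_iff.2 hw), EReal.coe_div]

/-- The rescaled polynomial `A⁻¹ q` is a competitor in the supremum defining `V`. -/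
theorem norm_eval_le_exp_of_totalDegree_eq (hV : ∀ z, (V z : EReal) = weightedGreen K Q z)
    (hn : 1 ≤ n) {q : MvPolynomial (Fin m) ℂ} (hq : q.totalDegree = n) {A : ℝ} (hA : 0 < A)
    (hqA : ∀ z ∈ K, ‖MvPolynomial.eval z q‖ * Real.exp (-(n : ℝ) * Q z) ≤ A) (z : Fin m → ℂ) :
    ‖MvPolynomial.eval z q‖ ≤ A * Real.exp (n * V z) := by
  rcases eq_or_ne (MvPolynomial.eval z q) 0 with h0 | h0
  · rw [h0, norm_zero]; positivity
  have hA' : ((A⁻¹ : ℝ) : ℂ) ≠ 0 := by exact_mod_cast (inv_pos.2 hA).ne'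
  set r : MvPolynomial (Fin m) ℂ := MvPolynomial.C ((A⁻¹ : ℝ) : ℂ) * q with hr
  have hrd : r.totalDegree = n := by
    rw [hr, MvPolynomial.totalDegree_C_mul_of_ne_zero hA', hq]
  have hre : ∀ w, ‖MvPolynomial.eval w r‖ = A⁻¹ * ‖MvPolynomial.eval w q‖ := by
    intro w
    simp [hr, abs_of_pos hA]
  have hr0 : MvPolynomial.eval z r ≠ 0 := by
    simp [hr, hA.ne', h0]
  have hle : ENNReal.log ‖MvPolynomial.eval z r‖ₑ / ((r.totalDegree : ℝ) : EReal) ≤ V z := by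
    rw [hV]
    refine le_iSup₂_of_le r (by omega) (le_iSup_of_le (fun w hw => ?_) le_rfl)
    rw [hrd, hre, mul_assoc]
    exact (inv_mul_le_one₀ hA).2 (hqA w hw)
  rw [log_enorm_div_natCast_eq hr0, EReal.coe_le_coe_iff, hrd,
    div_le_iff₀ (by exact_mod_cast hn), Real.log_le_iff_le_exp (norm_pos_iff.2 hr0), hre,
    inv_mul_le_iff₀ hA, mul_comm (V z)] at hle
  exact hle

/-- The definition of `V` ties the weight to the exact degree. A polynomial of lower degree is
perturbed by `ε z_0^n`, which has degree exactly `n` (here `m ≥ 1` is needed), and then `ε → 0`. -/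
theorem norm_eval_le_exp (hm : 1 ≤ m) (hK : IsCompact K) (hQ : ContinuousOn Q K)
    (hV : ∀ z, (V z : EReal) = weightedGreen K Q z)
    (hn : 1 ≤ n) {q : MvPolynomial (Fin m) ℂ} (hq : q.totalDegree ≤ n) {A : ℝ} (hA : 0 < A)
    (hqA : ∀ z ∈ K, ‖MvPolynomial.eval z q‖ * Real.exp (-(n : ℝ) * Q z) ≤ A) (z : Fin m → ℂ) :
    ‖MvPolynomial.eval z q‖ ≤ A * Real.exp (n * V z) := by
  rcases hq.eq_or_lt with h | h
  · exact norm_eval_le_exp_of_totalDegree_eq hV hn h hA hqA z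
  set i : Fin m := ⟨0, hm⟩
  obtain ⟨B, hB⟩ := hK.exists_bound_of_continuousOn
    (f := fun w : Fin m → ℂ => ‖w i ^ n‖ * Real.exp (-(n : ℝ) * Q w))
    (((continuous_apply i).pow n).norm.continuousOn.mul
      (Real.continuous_exp.comp_continuousOn (continuousOn_const.mul hQ)))
  have key : ∀ ε : ℝ, 0 < ε → ‖MvPolynomial.eval z q + ε * z i ^ n‖ ≤
      (A + ε * |B|) * Real.exp (n * V z) := by
    intro ε hε
    have hε' : (ε : ℂ) ≠ 0 := by exact_mod_cast hε.ne'
    have hdX : (MvPolynomial.C (ε : ℂ) * MvPolynomial.X i ^ n :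
        MvPolynomial (Fin m) ℂ).totalDegree = n := by
      rw [MvPolynomial.totalDegree_C_mul_of_ne_zero hε', MvPolynomial.totalDegree_X_pow]
    have := norm_eval_le_exp_of_totalDegree_eq hV hn
      (q := q + MvPolynomial.C (ε : ℂ) * MvPolynomial.X i ^ n) (A := A + ε * |B|) ?_
      (by positivity) (fun w hw => ?_) z
    · simpa using this
    · rw [MvPolynomial.totalDegree_add_eq_right_of_totalDegree_lt (by rwa [hdX]), hdX]
    · have h1 := hqA w hw
      have h2 := (le_abs_self _).trans ((hB w hw).trans (le_abs_self B))
      have h3 : ‖MvPolynomial.eval w q + ε * w i ^ n‖ ≤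
          ‖MvPolynomial.eval w q‖ + ε * ‖w i ^ n‖ := by
        refine (norm_add_le _ _).trans_eq ?_
        rw [norm_mul, Complex.norm_of_nonneg hε.le]
      simp only [map_add, map_mul, MvPolynomial.eval_C, map_pow, MvPolynomial.eval_X]
      calc _ ≤ (‖MvPolynomial.eval w q‖ + ε * ‖w i ^ n‖) * Real.exp (-(n : ℝ) * Q w) := by gcongr
        _ = ‖MvPolynomial.eval w q‖ * Real.exp (-(n : ℝ) * Q w) +
            ε * (‖w i ^ n‖ * Real.exp (-(n : ℝ) * Q w)) := by ring
        _ ≤ A + ε * |B| := by gcongr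
  have hl : Tendsto (fun ε : ℝ => ‖MvPolynomial.eval z q + ε * z i ^ n‖) (𝓝[>] 0)
      (𝓝 ‖MvPolynomial.eval z q‖) := by
    have : Continuous (fun ε : ℝ => ‖MvPolynomial.eval z q + ε * z i ^ n‖) := by fun_prop
    simpa using (this.tendsto 0).mono_left nhdsWithin_le_nhds
  have hr : Tendsto (fun ε : ℝ => (A + ε * |B|) * Real.exp (n * V z)) (𝓝[>] 0)
      (𝓝 (A * Real.exp (n * V z))) := by
    have : Continuous (fun ε : ℝ => (A + ε * |B|) * Real.exp (n * V z)) := by fun_prop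
    simpa using (this.tendsto 0).mono_left nhdsWithin_le_nhds
  exact le_of_tendsto_of_tendsto hl hr (eventually_mem_nhdsWithin.mono key)

end Green

/-! ### Asymptotics of the Bergman functions -/

/-- The maximum with `1` makes the sequence nonnegative, so the upper bound from the limsup suffices
for convergence. -/
theorem tendsto_log_max_one_div_of_limsup_rpow {M : ℕ → ℝ≥0}
    (hM : limsup (fun n : ℕ => (M n : ℝ≥0∞) ^ (1 / (n : ℝ))) atTop = 1) :
    Tendsto (fun n : ℕ => Real.log (max 1 (M n)) / n) atTop (𝓝 0) := by
  rw [tendsto_order]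
  refine ⟨fun a ha => .of_forall fun n => ha.trans_le ?_, fun a ha => ?_⟩
  · exact div_nonneg (Real.log_nonneg (le_max_left _ _)) n.cast_nonneg
  have h1 : limsup (fun n : ℕ => (M n : ℝ≥0∞) ^ (1 / (n : ℝ))) atTop <
      ENNReal.ofReal (Real.exp a) := by
    rw [hM, ENNReal.one_lt_ofReal]
    exact Real.one_lt_exp_iff.2 ha
  filter_upwards [eventually_lt_of_limsup_lt h1, eventually_gt_atTop 0] with n hn hn0
  have hn0' : (0 : ℝ) < n := by exact_mod_cast hn0
  rw [div_lt_iff₀ hn0', Real.log_lt_iff_lt_exp (by positivity), max_lt_iff]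
  refine ⟨Real.one_lt_exp_iff.2 (by positivity), ?_⟩
  rw [one_div, ← ENNReal.coe_rpow_of_nonneg _ (by positivity), ← ENNReal.ofReal_coe_nnreal,
    ENNReal.ofReal_lt_ofReal_iff (Real.exp_pos _), NNReal.coe_rpow] at hn
  have := (Real.rpow_inv_lt_iff_of_pos (M n).2 (Real.exp_pos a).le hn0').1 hn
  rwa [← Real.exp_mul] at this

theorem tendsto_log_natCast_div : Tendsto (fun n : ℕ => Real.log n / n) atTop (𝓝 0) :=
  Real.isLittleO_log_id_atTop.tendsto_div_nhds_zero.comp tendsto_natCast_atTop_atTop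

theorem tendsto_log_choose_div (m : ℕ) :
    Tendsto (fun n : ℕ => Real.log ((m + n).choose n) / n) atTop (𝓝 0) := by
  have h : Tendsto (fun n : ℕ => (m : ℝ) * (Real.log (m + 1) / n + Real.log n / n)) atTop
      (𝓝 0) := by
    simpa using ((tendsto_const_div_atTop_nhds_zero_nat (Real.log (m + 1))).add
      tendsto_log_natCast_div).const_mul (m : ℝ)
  refine squeeze_zero' (.of_forall fun n => ?_) ?_ h
  · exact div_nonneg (Real.log_natCast_nonneg _) n.cast_nonneg
  filter_upwards [eventually_ge_atTop 1] with n hn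
  have hn' : (0 : ℝ) < n := by exact_mod_cast hn
  rw [← add_div, ← mul_div_assoc]
  gcongr
  rw [← Real.log_mul (by positivity) hn'.ne', ← Real.log_pow]
  refine Real.log_le_log (by exact_mod_cast Nat.choose_pos (by omega)) ?_
  -- Polynomial growth for fixed `m`: `binom(m+n, m) ≤ (m+n)^m`, and `m + n ≤ (m+1) n` as `n ≥ 1`.
  have h1 : (m + n).choose n ≤ ((m + 1) * n) ^ m := by
    rw [← Nat.choose_symm_add]
    refine (Nat.choose_le_pow _ _).trans (Nat.pow_le_pow_left ?_ m)
    nlinarith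
  exact_mod_cast h1

section Bergman

variable {m : ℕ} {K : Set (Fin m → ℂ)} {Q V : (Fin m → ℂ) → ℝ} {τ : Measure (Fin m → ℂ)}

theorem log_norm_polyVec_div_le (hm : 1 ≤ m) (hK : IsCompact K) (hQ : ContinuousOn Q K)
    (hV : ∀ z, (V z : EReal) = weightedGreen K Q z) {n N : ℕ} (hn : 1 ≤ n) (hN : 1 ≤ N)
    {M : ℝ≥0} (hM : ∀ p : MvPolynomial (Fin m) ℂ, p.totalDegree ≤ n → ∀ z ∈ K,
      ‖MvPolynomial.eval z p‖ * Real.exp (-(n : ℝ) * Q z) ≤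
        M * Real.sqrt (∫ w, (‖MvPolynomial.eval w p‖ * Real.exp (-(n : ℝ) * Q w)) ^ 2 ∂τ))
    {p : Fin N → MvPolynomial (Fin m) ℂ} (hp : IsOrthonormalPolyBasis Q τ n p) (z : Fin m → ℂ) :
    Real.log ‖polyVec p z‖ / n ≤ V z + (Real.log N / n + Real.log (max 1 (M : ℝ)) / n) := by
  have hn' : (0 : ℝ) < n := by exact_mod_cast hn
  have hN' : (0 : ℝ) < N := by exact_mod_cast hN
  have h1 : ∀ i, ‖MvPolynomial.eval z (p i)‖ ≤ max 1 (M : ℝ) * Real.exp (n * V z) := by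
    intro i
    refine norm_eval_le_exp hm hK hQ hV hn (hp.totalDegree_le i) (by positivity)
      (fun w hw => ?_) z
    have := hM (p i) (hp.totalDegree_le i) w hw
    rw [hp.integral_sq_eq_one, Real.sqrt_one, mul_one] at this
    exact this.trans (le_max_right _ _)
  have h2 : ‖polyVec p z‖ ≤ N * (max 1 (M : ℝ) * Real.exp (n * V z)) := by
    calc ‖polyVec p z‖ = ‖∑ i, EuclideanSpace.single i (polyVec p z i)‖ := by
          congr 1
          ext j
          simp [Finset.sum_apply]
      _ ≤ ∑ i, ‖MvPolynomial.eval z (p i)‖ := by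
          refine (norm_sum_le _ _).trans_eq (Finset.sum_congr rfl fun i _ => ?_)
          simp [polyVec]
      _ ≤ ∑ _ : Fin N, max 1 (M : ℝ) * Real.exp (n * V z) := Finset.sum_le_sum fun i _ => h1 i
      _ = _ := by simp
  have h3 := Real.log_le_log (norm_pos_iff.2 (hp.polyVec_ne_zero z)) h2
  rw [Real.log_mul hN'.ne' (by positivity), Real.log_mul (by positivity) (Real.exp_ne_zero _),
    Real.log_exp] at h3
  rw [← add_div, div_le_iff₀ hn', add_mul, div_mul_cancel₀ _ hn'.ne']
  linarith

/-- Test the Bergman bound on the constant `1`, whose weighted sup norm is at most `e^{nB}`. Unlike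
the competitor bound, this is uniform in `z` and `n`, as domination requires. -/
theorem neg_le_log_norm_polyVec_div [IsProbabilityMeasure τ] (hK : IsCompact K)
    (hQ : ContinuousOn Q K) (hτ : τ Kᶜ = 0) {B : ℝ} (hB : ∀ z ∈ K, ‖Q z‖ ≤ B)
    {n N : ℕ} (hn : 1 ≤ n)
    {p : Fin N → MvPolynomial (Fin m) ℂ} (hp : IsOrthonormalPolyBasis Q τ n p) (z : Fin m → ℂ) :
    -B ≤ Real.log ‖polyVec p z‖ / n := by
  have hn' : (0 : ℝ) < n := by exact_mod_cast hn
  have h := hp.norm_eval_le hK hQ hτ (q := 1) (by simp) (A := Real.exp (n * B)) (by positivity)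
    (fun w hw => ?_) z
  · rw [map_one, norm_one] at h
    have h0 := norm_pos_iff.2 (hp.polyVec_ne_zero z)
    have h1 := Real.log_le_log one_pos h
    rw [Real.log_one, Real.log_mul (Real.exp_ne_zero _) h0.ne', Real.log_exp] at h1
    rw [le_div_iff₀ hn']
    linarith
  · rw [map_one, norm_one, one_mul, Real.exp_le_exp]
    have := (abs_le.1 (hB w hw)).1
    nlinarith

/-- Write `n = dk + r` with `r < d` and test the Bergman bound on `q^k`. The leftover weight
`e^{-rQ}` costs at most `e^{dB}`, and replacing `k` by `n/d` costs at most `|log |q(z)||`; both are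
`O(1)` before division by `n`. -/
theorem le_log_norm_polyVec_div_of_weightedNormLeOne [IsProbabilityMeasure τ] (hK : IsCompact K)
    (hQ : ContinuousOn Q K) (hτ : τ Kᶜ = 0) {B : ℝ} (hB : ∀ z ∈ K, ‖Q z‖ ≤ B)
    {n N : ℕ} (hn : 1 ≤ n)
    {p : Fin N → MvPolynomial (Fin m) ℂ} (hp : IsOrthonormalPolyBasis Q τ n p)
    {q : MvPolynomial (Fin m) ℂ} (hd : 1 ≤ q.totalDegree)
    (hq : WeightedNormLeOne K Q q.totalDegree q) (z : Fin m → ℂ)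
    (hz : MvPolynomial.eval z q ≠ 0) :
    Real.log ‖MvPolynomial.eval z q‖ / q.totalDegree -
      (|Real.log ‖MvPolynomial.eval z q‖| + q.totalDegree * B) / n ≤
      Real.log ‖polyVec p z‖ / n := by
  have hn' : (0 : ℝ) < n := by exact_mod_cast hn
  set d := q.totalDegree
  have hd' : (1 : ℝ) ≤ d := by exact_mod_cast hd
  have hdn : d * (n / d) + n % d = n := Nat.div_add_mod n d
  have hr : n % d < d := Nat.mod_lt _ (by omega)
  set k := n / d
  set r := n % d
  have hdn' : (d : ℝ) * k + r = n := by exact_mod_cast hdn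
  have hr' : (r : ℝ) ≤ d := by exact_mod_cast hr.le
  have h := hp.norm_eval_le hK hQ hτ (q := q ^ k) ?_ (A := Real.exp (d * B)) (by positivity)
    (fun w hw => ?_) z
  · have h0 := norm_pos_iff.2 (hp.polyVec_ne_zero z)
    have hz0 := norm_pos_iff.2 hz
    rw [map_pow, norm_pow] at h
    have h1 := Real.log_le_log (by positivity) h
    rw [Real.log_pow, Real.log_mul (Real.exp_ne_zero _) h0.ne', Real.log_exp] at h1
    set t := Real.log ‖MvPolynomial.eval z q‖
    rw [le_div_iff₀ hn', sub_mul, div_mul_cancel₀ _ hn'.ne']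
    have h2 : t / d * n ≤ k * t + |t| := by
      have h3 : t / d * n = k * t + (r / d) * t := by
        rw [← hdn']; field_simp
      have h4 : (r / d : ℝ) ≤ 1 := div_le_one_of_le₀ hr' (by positivity)
      have h5 : (r / d : ℝ) * t ≤ 1 * |t| :=
        (mul_le_mul_of_nonneg_left (le_abs_self t) (by positivity)).trans
          (mul_le_mul_of_nonneg_right h4 (abs_nonneg t))
      rw [h3]
      linarith
    linarith
  · exact (MvPolynomial.totalDegree_pow _ _).trans
      ((Nat.mul_comm _ _).trans_le (hdn ▸ Nat.le_add_right _ _))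
  · have h1 : ‖MvPolynomial.eval w (q ^ k)‖ * Real.exp (-(n : ℝ) * Q w) =
        (‖MvPolynomial.eval w q‖ * Real.exp (-(d : ℝ) * Q w)) ^ k *
          Real.exp (-(r : ℝ) * Q w) := by
      rw [map_pow, norm_pow, mul_pow, mul_assoc, ← Real.exp_nat_mul, ← Real.exp_add, ← hdn']
      congr 2
      ring
    rw [h1, ← one_mul (Real.exp (d * B))]
    refine mul_le_mul (pow_le_one₀ (by positivity) (hq w hw)) (Real.exp_le_exp.2 ?_)
      (by positivity) zero_le_one
    calc -(r : ℝ) * Q w ≤ r * ‖Q w‖ := by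
          rw [neg_mul, ← mul_neg]
          gcongr
          exact neg_le_abs _
      _ ≤ d * B := by gcongr; exact hB w hw

variable {p : (n : ℕ) → Fin ((m + n).choose n) → MvPolynomial (Fin m) ℂ}

theorem tendsto_log_norm_polyVec_div [IsProbabilityMeasure τ] (hm : 1 ≤ m) (hK : IsCompact K)
    (hQ : ContinuousOn Q K) (hτ : τ Kᶜ = 0) (hBM : WeightedBernsteinMarkov K Q τ)
    (hV : ∀ z, (V z : EReal) = weightedGreen K Q z)
    (hp : ∀ n, 1 ≤ n → IsOrthonormalPolyBasis Q τ n (p n)) (z : Fin m → ℂ) :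
    Tendsto (fun n : ℕ => Real.log ‖polyVec (p n) z‖ / n) atTop (𝓝 (V z)) := by
  obtain ⟨M, hM, hMlim⟩ := hBM
  rw [tendsto_order]
  constructor
  · intro a ha
    have ha' : (a : EReal) < weightedGreen K Q z := by rw [← hV]; exact_mod_cast ha
    simp only [weightedGreen, lt_iSup_iff] at ha'
    obtain ⟨q, hd, hq, haq⟩ := ha'
    have hd' : (0 : ℝ) < q.totalDegree := by exact_mod_cast hd
    -- A vanishing value would make the competitor's term `-∞`, which cannot exceed `a`.
    have hz : MvPolynomial.eval z q ≠ 0 := by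
      intro h0
      rw [h0, enorm_zero, ENNReal.log_zero, EReal.bot_div_of_pos_ne_top
        (by exact_mod_cast hd') (EReal.coe_ne_top _)] at haq
      exact not_lt_bot haq
    rw [log_enorm_div_natCast_eq hz, EReal.coe_lt_coe_iff] at haq
    obtain ⟨B, hB⟩ := hK.exists_bound_of_continuousOn hQ
    have hlim : Tendsto (fun n : ℕ => Real.log ‖MvPolynomial.eval z q‖ / q.totalDegree -
        (|Real.log ‖MvPolynomial.eval z q‖| + q.totalDegree * B) / n) atTop
        (𝓝 (Real.log ‖MvPolynomial.eval z q‖ / q.totalDegree)) := by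
      simpa using (tendsto_const_div_atTop_nhds_zero_nat
        (|Real.log ‖MvPolynomial.eval z q‖| + q.totalDegree * B)).const_sub
        (Real.log ‖MvPolynomial.eval z q‖ / q.totalDegree)
    filter_upwards [hlim.eventually_const_lt haq, eventually_ge_atTop 1] with n hn hn1
    exact hn.trans_le (le_log_norm_polyVec_div_of_weightedNormLeOne hK hQ hτ hB hn1
      (hp n hn1) hd hq z hz)
  · intro a ha
    have hlim := ((tendsto_log_choose_div m).add
      (tendsto_log_max_one_div_of_limsup_rpow hMlim)).const_add (V z)
    rw [add_zero, add_zero] at hlim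
    filter_upwards [hlim.eventually_lt_const ha, eventually_ge_atTop 1] with n hn hn1
    exact (log_norm_polyVec_div_le hm hK hQ hV hn1 (Nat.choose_pos (by omega)) (hM n hn1)
      (hp n hn1) z).trans_lt hn

/-- The functions `(1 / n) log ‖polyVec (p n)‖` are locally uniformly bounded. -/
theorem eventually_abs_log_norm_polyVec_div_le [IsProbabilityMeasure τ] (hm : 1 ≤ m)
    (hK : IsCompact K)
    (hQ : ContinuousOn Q K) (hτ : τ Kᶜ = 0) (hBM : WeightedBernsteinMarkov K Q τ)
    (hV : ∀ z, (V z : EReal) = weightedGreen K Q z) (hVc : Continuous V)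
    (hp : ∀ n, 1 ≤ n → IsOrthonormalPolyBasis Q τ n (p n))
    {S : Set (Fin m → ℂ)} (hS : IsCompact S) :
    ∃ B : ℝ, ∀ᶠ n : ℕ in atTop, ∀ z ∈ S, |Real.log ‖polyVec (p n) z‖ / n| ≤ B := by
  obtain ⟨M, hM, hMlim⟩ := hBM
  obtain ⟨B, hB⟩ := hK.exists_bound_of_continuousOn hQ
  obtain ⟨W, hW⟩ := hS.exists_bound_of_continuousOn hVc.continuousOn
  refine ⟨max B (W + 1), ?_⟩
  have hlim := (tendsto_log_choose_div m).add (tendsto_log_max_one_div_of_limsup_rpow hMlim)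
  -- The upper error does not depend on `z` and is eventually below `1`, whence `W + 1`; continuity
  -- of `V` serves only to supply `W`.
  rw [add_zero] at hlim
  filter_upwards [hlim.eventually_lt_const one_pos, eventually_ge_atTop 1] with n hn hn1 z hz
  have h1 := log_norm_polyVec_div_le hm hK hQ hV hn1 (Nat.choose_pos (by omega)) (hM n hn1)
    (hp n hn1) z
  have h2 := neg_le_log_norm_polyVec_div hK hQ hτ hB hn1 (hp n hn1) z
  have h3 := (abs_le.1 (hW z hz)).2
  refine abs_le.2 ⟨?_, ?_⟩
  · linarith [le_max_left B (W + 1)]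
  · linarith [le_max_right B (W + 1)]

end Bergman

/-! ### Expected zero currents -/

section Currents

variable {m n N : ℕ} {Q : (Fin m → ℂ) → ℝ} {τ : Measure (Fin m → ℂ)}
  {p : Fin N → MvPolynomial (Fin m) ℂ} {P : Measure (EuclideanSpace ℂ (Fin N))}

theorem logAbs_polyOfCoeffs (p : Fin N → MvPolynomial (Fin m) ℂ)
    (a : EuclideanSpace ℂ (Fin N)) (z : Fin m → ℂ) :
    logAbs (polyOfCoeffs p a) z = Real.log ‖inner ℂ (polyVec p z) a‖ := by
  rw [inner_polyVec, logAbs]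

theorem integrable_prod_logAbs [IsProbabilityMeasure P]
    (hI : ∀ u, ‖u‖ = 1 → LogInnerIntegrable P u) {c : ℝ}
    (hc : ∀ u, ‖u‖ = 1 → -c ≤ logAverage P u) (hp : IsOrthonormalPolyBasis Q τ n p)
    {S : Set (Fin m → ℂ)} (hS : IsCompact S) :
    Integrable (fun x : EuclideanSpace ℂ (Fin N) × (Fin m → ℂ) =>
      logAbs (polyOfCoeffs p x.1) x.2) (P.prod (volume.restrict S)) := by
  obtain ⟨D, hD⟩ := exists_integral_abs_log_inner_le hI hc
  have : IsFiniteMeasure (volume.restrict S) := isFiniteMeasure_restrict.2 hS.measure_ne_top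
  simp only [logAbs_polyOfCoeffs]
  refine integrable_prod_log_norm_inner hI hD (continuous_polyVec p).measurable
    hp.polyVec_ne_zero ?_
  refine ContinuousOn.integrableOn_compact hS (Continuous.continuousOn ?_)
  exact (continuous_polyVec p).norm.log fun z => norm_ne_zero_iff.2 (hp.polyVec_ne_zero z)

theorem ae_locallyIntegrable_logAbs [IsProbabilityMeasure P]
    (hI : ∀ u, ‖u‖ = 1 → LogInnerIntegrable P u) {c : ℝ}
    (hc : ∀ u, ‖u‖ = 1 → -c ≤ logAverage P u) (hp : IsOrthonormalPolyBasis Q τ n p) :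
    ∀ᵐ a ∂P, LocallyIntegrable (logAbs (polyOfCoeffs p a)) := by
  -- Countably many balls exhaust the space, so a single null set serves for all compact sets.
  have h : ∀ᵐ a ∂P, ∀ R : ℕ,
      IntegrableOn (logAbs (polyOfCoeffs p a)) (Metric.closedBall 0 R) :=
    ae_all_iff.2 fun R =>
      (integrable_prod_logAbs hI hc hp (isCompact_closedBall 0 (R : ℝ))).prod_right_ae
  filter_upwards [h] with a ha
  rw [locallyIntegrable_iff]
  intro S hS
  obtain ⟨R, hR⟩ := hS.isBounded.subset_closedBall 0
  exact (ha ⌈R⌉₊).mono_set (hR.trans (Metric.closedBall_subset_closedBall (Nat.le_ceil R)))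

/-- The density of `dd^c α` with respect to Lebesgue measure. -/
def ddcDensity (α : (Fin m → ℂ) → (Fin m → ℂ) [⋀^Fin (2 * (m - 1))]→L[ℝ] ℂ)
    (z : Fin m → ℂ) : ℂ :=
  ddcForm α z (stdFrame m (2 * (m - 1) + 1 + 1))

variable {α : (Fin m → ℂ) → (Fin m → ℂ) [⋀^Fin (2 * (m - 1))]→L[ℝ] ℂ}

theorem IsTestForm.continuous_ddcDensity (hα : IsTestForm α) : Continuous (ddcDensity α) :=
  (continuous_ddcForm hα.smooth).eval_const _

theorem IsTestForm.hasCompactSupport_ddcDensity (hα : IsTestForm α) :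
    HasCompactSupport (ddcDensity α) :=
  (hasCompactSupport_ddcForm hα.compactSupport).comp_left
    (g := fun β : (Fin m → ℂ) [⋀^Fin (2 * (m - 1) + 1 + 1)]→L[ℝ] ℂ =>
      β (stdFrame m (2 * (m - 1) + 1 + 1))) rfl

/-- Localising to a compact set gives a finite measure, on which Fubini and constant majorants are
available. -/
theorem ddcCurrent_eq_setIntegral (u : (Fin m → ℂ) → ℝ) :
    ddcCurrent u α = ∫ z in tsupport (ddcDensity α), (u z : ℂ) * ddcDensity α z := by
  refine (setIntegral_eq_integral_of_forall_compl_eq_zero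
    (f := fun z => (u z : ℂ) * ddcDensity α z) fun z hz => ?_).symm
  rw [image_eq_zero_of_notMem_tsupport hz, mul_zero]

theorem integrable_prod_logAbs_mul_ddcDensity [IsProbabilityMeasure P]
    (hI : ∀ u, ‖u‖ = 1 → LogInnerIntegrable P u) {c : ℝ}
    (hc : ∀ u, ‖u‖ = 1 → -c ≤ logAverage P u) (hp : IsOrthonormalPolyBasis Q τ n p)
    (hα : IsTestForm α) :
    Integrable (fun x : EuclideanSpace ℂ (Fin N) × (Fin m → ℂ) =>
      (logAbs (polyOfCoeffs p x.1) x.2 : ℂ) * ddcDensity α x.2)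
      (P.prod (volume.restrict (tsupport (ddcDensity α)))) := by
  obtain ⟨G, hG⟩ := hα.continuous_ddcDensity.bounded_above_of_compact_support
    hα.hasCompactSupport_ddcDensity
  exact (integrable_prod_logAbs hI hc hp hα.hasCompactSupport_ddcDensity.isCompact).ofReal.mul_bdd
    (hα.continuous_ddcDensity.comp continuous_snd).aestronglyMeasurable (.of_forall fun x => hG x.2)

theorem integrable_normalizedZeroCurrent [IsProbabilityMeasure P]
    (hI : ∀ u, ‖u‖ = 1 → LogInnerIntegrable P u) {c : ℝ}
    (hc : ∀ u, ‖u‖ = 1 → -c ≤ logAverage P u) (hp : IsOrthonormalPolyBasis Q τ n p)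
    (hα : IsTestForm α) :
    Integrable (fun a => normalizedZeroCurrent n (polyOfCoeffs p a) α) P := by
  simp only [normalizedZeroCurrent, ddcCurrent_eq_setIntegral]
  exact (integrable_prod_logAbs_mul_ddcDensity hI hc hp hα).integral_prod_left.const_mul _

theorem expectedZeroCurrent_eq [IsProbabilityMeasure P]
    (hI : ∀ u, ‖u‖ = 1 → LogInnerIntegrable P u) {c : ℝ}
    (hc : ∀ u, ‖u‖ = 1 → -c ≤ logAverage P u) (hp : IsOrthonormalPolyBasis Q τ n p)
    (hα : IsTestForm α) :
    expectedZeroCurrent n p P α = ∫ z in tsupport (ddcDensity α),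
      (((∫ a, logAbs (polyOfCoeffs p a) z ∂P) / n : ℝ) : ℂ) * ddcDensity α z := by
  simp only [expectedZeroCurrent, normalizedZeroCurrent, ddcCurrent_eq_setIntegral]
  rw [integral_const_mul, integral_integral_swap
    (integrable_prod_logAbs_mul_ddcDensity hI hc hp hα), ← integral_const_mul]
  refine integral_congr_ae (.of_forall fun z => ?_)
  dsimp only
  rw [integral_mul_const, integral_complex_ofReal]
  push_cast
  ring

theorem integrable_integral_logAbs [IsProbabilityMeasure P]
    (hI : ∀ u, ‖u‖ = 1 → LogInnerIntegrable P u) {c : ℝ}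
    (hc : ∀ u, ‖u‖ = 1 → -c ≤ logAverage P u) (hp : IsOrthonormalPolyBasis Q τ n p)
    {S : Set (Fin m → ℂ)} (hS : IsCompact S) :
    IntegrableOn (fun z => ∫ a, logAbs (polyOfCoeffs p a) z ∂P) S :=
  (integrable_prod_logAbs hI hc hp hS).integral_prod_right

theorem abs_integral_logAbs_sub_le [IsProbabilityMeasure P]
    (hI : ∀ u, ‖u‖ = 1 → LogInnerIntegrable P u) {c : ℝ}
    (hc : ∀ u, ‖u‖ = 1 → |logAverage P u| ≤ c) (hp : IsOrthonormalPolyBasis Q τ n p)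
    (z : Fin m → ℂ) :
    |(∫ a, logAbs (polyOfCoeffs p a) z ∂P) / n - Real.log ‖polyVec p z‖ / n| ≤ c / n := by
  simp only [logAbs_polyOfCoeffs]
  rw [integral_log_norm_inner hI (hp.polyVec_ne_zero z), ← sub_div, add_sub_cancel_left, abs_div,
    Nat.abs_cast]
  gcongr
  exact hc _ (norm_normalize_eq_one _ (hp.polyVec_ne_zero z))

end Currents

end

theorem mainTheorem9 (m : ℕ) (hm : 1 ≤ m)
    (K : Set (Fin m → ℂ)) (hK : IsCompact K)
    (Q : (Fin m → ℂ) → ℝ) (hQ : ContinuousOn Q K)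
    (τ : Measure (Fin m → ℂ)) [IsProbabilityMeasure τ] (hτ : τ Kᶜ = 0)
    (hBM : WeightedBernsteinMarkov K Q τ)
    -- `V_{K,Q}` is finite and continuous
    (V : (Fin m → ℂ) → ℝ) (hV : ∀ z, (V z : EReal) = weightedGreen K Q z) (hVc : Continuous V)
    -- orthonormal bases of the polynomials of degree at most `n`; `m_n = (m + n).choose n`
    (p : (n : ℕ) → Fin ((m + n).choose n) → MvPolynomial (Fin m) ℂ)
    (hp : ∀ n, 1 ≤ n → IsOrthonormalPolyBasis Q τ n (p n))
    -- the laws of the coefficient vectors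
    (P : (n : ℕ) → Measure (EuclideanSpace ℂ (Fin ((m + n).choose n))))
    [∀ n, IsProbabilityMeasure (P n)]
    (hI : ∀ n, 2 ≤ n → ∀ u, ‖u‖ = 1 → LogInnerIntegrable (P n) u)
    (C : ℝ) (hC : ∀ n, 2 ≤ n → ∀ u, ‖u‖ = 1 → |logAverage (P n) u| ≤ C * Real.log n) :
    -- the expected currents are well defined
    (∀ n, 2 ≤ n → (∀ᵐ a ∂(P n), LocallyIntegrable (logAbs (polyOfCoeffs (p n) a))) ∧
      ∀ α : (Fin m → ℂ) → (Fin m → ℂ) [⋀^Fin (2 * (m - 1))]→L[ℝ] ℂ, IsTestForm α →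
        Integrable (fun a => normalizedZeroCurrent n (polyOfCoeffs (p n) a) α) (P n)) ∧
    -- and they converge to `dd^c V_{K,Q}`
    ∀ α : (Fin m → ℂ) → (Fin m → ℂ) [⋀^Fin (2 * (m - 1))]→L[ℝ] ℂ, IsTestForm α →
      Tendsto (fun n => expectedZeroCurrent n (p n) (P n) α) atTop (𝓝 (ddcCurrent V α)) := by
  have hc : ∀ n : ℕ, 2 ≤ n → ∀ u, ‖u‖ = 1 → -(C * Real.log n) ≤ logAverage (P n) u :=
    fun n hn u hu => (abs_le.1 (hC n hn u hu)).1
  refine ⟨fun n hn => ⟨ae_locallyIntegrable_logAbs (hI n hn) (hc n hn) (hp n (by omega)),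
    fun α hα => integrable_normalizedZeroCurrent (hI n hn) (hc n hn) (hp n (by omega)) hα⟩,
    fun α hα => ?_⟩
  have hS := hα.hasCompactSupport_ddcDensity.isCompact
  have : IsFiniteMeasure (volume.restrict (tsupport (ddcDensity α))) :=
    isFiniteMeasure_restrict.2 hS.measure_ne_top
  obtain ⟨G, hG⟩ := hα.continuous_ddcDensity.bounded_above_of_compact_support
    hα.hasCompactSupport_ddcDensity
  obtain ⟨B, hB⟩ := eventually_abs_log_norm_polyVec_div_le hm hK hQ hτ hBM hV hVc hp hS
  have hlog : Tendsto (fun n : ℕ => C * Real.log n / n) atTop (𝓝 0) := by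
    simpa [mul_div_assoc] using tendsto_log_natCast_div.const_mul C
  have hlim : ∀ z, Tendsto (fun n : ℕ => (∫ a, logAbs (polyOfCoeffs (p n) a) z ∂(P n)) / n) atTop
      (𝓝 (V z)) := by
    intro z
    have h1 := tendsto_log_norm_polyVec_div hm hK hQ hτ hBM hV hp z
    have h2 : Tendsto (fun n : ℕ => (∫ a, logAbs (polyOfCoeffs (p n) a) z ∂(P n)) / n -
        Real.log ‖polyVec (p n) z‖ / n) atTop (𝓝 0) := by
      refine squeeze_zero_norm' ?_ hlog
      filter_upwards [eventually_ge_atTop 2] with n hn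
      exact abs_integral_logAbs_sub_le (hI n hn) (hC n hn) (hp n (by omega)) z
    simpa using h2.add h1
  rw [ddcCurrent_eq_setIntegral]
  refine Tendsto.congr' (f₁ := fun n : ℕ => ∫ z in tsupport (ddcDensity α),
    (((∫ a, logAbs (polyOfCoeffs (p n) a) z ∂(P n)) / n : ℝ) : ℂ) * ddcDensity α z) ?_ ?_
  · filter_upwards [eventually_ge_atTop 2] with n hn
    exact (expectedZeroCurrent_eq (hI n hn) (hc n hn) (hp n (by omega)) hα).symm
  -- In the majorant, `B` bounds `(1/n) log ‖polyVec‖` on the support, `1` absorbs the error `C log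
  -- n / n` for large `n`, and `G` bounds the density of `dd^c α`.
  refine tendsto_integral_filter_of_dominated_convergence (fun _ => (B + 1) * G) ?_ ?_
    (integrable_const _) (.of_forall fun z => ?_)
  · filter_upwards [eventually_ge_atTop 2] with n hn
    refine AEStronglyMeasurable.mul ?_ hα.continuous_ddcDensity.aestronglyMeasurable
    exact Complex.continuous_ofReal.comp_aestronglyMeasurable
      ((integrable_integral_logAbs (hI n hn) (hc n hn) (hp n (by omega)) hS).div_const
        _).aestronglyMeasurable
  · filter_upwards [eventually_ge_atTop 2, hB, hlog.eventually_lt_const one_pos] with n hn hBn hCn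
    refine (ae_restrict_mem hS.measurableSet).mono fun z hz => ?_
    have h1 := abs_integral_logAbs_sub_le (hI n hn) (hC n hn) (hp n (by omega)) z
    have h2 := hBn z hz
    rw [norm_mul, Complex.norm_real, Real.norm_eq_abs]
    refine mul_le_mul ?_ (hG z) (norm_nonneg _) (by linarith [(abs_nonneg _).trans h2])
    have h3 := abs_sub_abs_le_abs_sub ((∫ a, logAbs (polyOfCoeffs (p n) a) z ∂(P n)) / n)
      (Real.log ‖polyVec (p n) z‖ / n)
    linarith
  · exact ((Complex.continuous_ofReal.tendsto _).comp (hlim z)).mul_const _
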